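/- Let $I=[0,1]$ with Lebesgue measure $\mu_{\mathrm{Leb}}$. For $f:I\to I$ let $I_{ap}(f)$ be the set of points $x\in I$ whose orbit $\{f^k(x):k\ge 0\}$ is infinite. For $n\ge 1$ and $x\in I_{ap}(f)$, the points $x,f(x),\dots,f^{n-1}(x)$ are distinct, and their order pattern is the unique permutation $\sigma\in S_n$ such that $f^{i-1}(x)<f^{j-1}(x)$ if and only if $\sigma(i)<\sigma(j)$, for all $1\le i,j\le n$. For $\sigma \in S_n$ let $$\boldsymbol{\mu}_n(f)(\sigma)=\mu_{\mathrm{Leb}}\{x\in I_{ap}(f) : x \text{ has order pattern } \sigma\}.$$ Then for every integer $n\ge 1$ there exists a function $f:I\to I$ that is (Borel) measurable and preserves Lebesgue measure, i.e. $\mu_{\mathrm{Leb}}(f^{-1}(S))=\mu_{\mathrm{Leb}}(S)$ for all measurable $S\subseteq I$, that is almost aperiodic, i.e. $\mu_{\mathrm{Leb}}(I\setminus I_{ap}(f))=0$, and for which $\boldsymbol{\mu}_n(f)$ is the uniform distribution on $S_n$, i.e. $\boldsymbol{\mu}_n(f)(\sigma)=\frac{1}{n!}$ for all $\sigma\in S_n$.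 -/

import Mathlib

open MeasureTheory
open scoped ENNReal Nat

/-- The order pattern of an `n`-tuple `y` in a linear order: the permutation `σ` for which
`y (σ⁻¹ 0), y (σ⁻¹ 1), …` are in increasing order, so that `σ i` is the rank of `y i`.
It is meaningful for tuples with distinct entries, and is only used for those. -/
def orderPattern {n : ℕ} {Y : Type*} [LinearOrder Y] (y : Fin n → Y) : Equiv.Perm (Fin n) :=
  (Tuple.sort y)⁻¹

/-- The defining property of the order pattern of a tuple with distinct entries. -/
theorem orderPattern_lt_iff {n : ℕ} {Y : Type*} [LinearOrder Y] {y : Fin n → Y}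
    (hy : Function.Injective y) (i j : Fin n) :
    y i < y j ↔ orderPattern y i < orderPattern y j := by
  have hm : StrictMono (y ∘ Tuple.sort y) :=
    (Tuple.monotone_sort y).strictMono_of_injective (hy.comp (Tuple.sort y).injective)
  have h := hm.lt_iff_lt (a := (Tuple.sort y)⁻¹ i) (b := (Tuple.sort y)⁻¹ j)
  simpa [orderPattern] using h

/-- The order pattern is the only permutation with its defining property. -/
theorem eq_orderPattern {n : ℕ} {Y : Type*} [LinearOrder Y] {y : Fin n → Y}
    (hy : Function.Injective y) (σ : Equiv.Perm (Fin n))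
    (hσ : ∀ i j, y i < y j ↔ σ i < σ j) : σ = orderPattern y := by
  have hm : StrictMono (σ * (orderPattern y)⁻¹ : Equiv.Perm (Fin n)) := by
    intro a b hab
    have h1 := orderPattern_lt_iff hy ((orderPattern y)⁻¹ a) ((orderPattern y)⁻¹ b)
    simp only [Equiv.Perm.inv_def, Equiv.apply_symm_apply] at h1
    exact (hσ _ _).1 (h1.2 hab)
  have h2 : σ * (orderPattern y)⁻¹ = 1 := by
    ext i
    have := congrArg (fun e : Fin n ≃o Fin n => e i)
      (Subsingleton.elim (hm.orderIsoOfSurjective _ (σ * (orderPattern y)⁻¹).surjective)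
        (OrderIso.refl _))
    simpa using congrArg Fin.val this
  exact mul_inv_eq_one.1 h2

/-- The set of aperiodic points of a self-map: those with infinite forward orbit. -/
def aperiodicPoints {X : Type*} (f : X → X) : Set X :=
  {x | (Set.range fun k : ℕ => f^[k] x).Infinite}

/-- The iterates of an aperiodic point are pairwise distinct. -/
theorem iterate_injective_of_mem_aperiodicPoints {X : Type*} {f : X → X} {x : X}
    (hx : x ∈ aperiodicPoints f) : Function.Injective fun k : ℕ => f^[k] x := by
  have key : ∀ a b : ℕ, a < b → f^[a] x ≠ f^[b] x := by
    intro a b hab h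
    apply hx
    refine ((Finset.range b).finite_toSet.image fun k : ℕ => f^[k] x).subset ?_
    rintro _ ⟨k, rfl⟩
    induction k using Nat.strong_induction_on with
    | _ k ih =>
      by_cases hk : k < b
      · exact ⟨k, by simpa using hk, rfl⟩
      · have e : f^[k] x = f^[k - b + a] x := by
          conv_lhs => rw [show k = (k - b) + b by omega]
          rw [Function.iterate_add_apply, Function.iterate_add_apply, h]
        have := ih (k - b + a) (by omega)
        simpa only [e] using this
  intro a b h
  rcases lt_trichotomy a b with hab | hab | hab
  · exact absurd h (key a b hab)
  · exact hab
  · exact absurd h.symm (key b a hab)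

/-- A self-map of `[0,1]` is almost aperiodic if Lebesgue almost every point is aperiodic. -/
def AlmostAperiodic (f : unitInterval → unitInterval) : Prop :=
  ∀ᵐ x ∂(volume : Measure unitInterval), x ∈ aperiodicPoints f

/-- The class of almost aperiodic self-maps of `[0,1]` that preserve Lebesgue measure. -/
def almostAperiodicMeasurePreserving : Set (unitInterval → unitInterval) :=
  {f | AlmostAperiodic f ∧ MeasurePreserving f (volume : Measure unitInterval) (volume : Measure unitInterval)}

/-- The distribution of order patterns of length `n` of `f`: the Lebesgue measure of the set of
aperiodic points `x` such that `(x, f x, …, f^{n-1} x)` has order pattern `σ`. -/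
noncomputable def patternDistribution (n : ℕ) (f : unitInterval → unitInterval) (σ : Equiv.Perm (Fin n)) : ℝ≥0∞ :=
  volume {x : unitInterval | x ∈ aperiodicPoints f ∧ orderPattern (fun i : Fin n => f^[(i : ℕ)] x) = σ}

/-! Cut `[0,1]` into `n! * n` equal cells, grouped in one block of `n` adjacent cells per
permutation `τ`, with position `p` placed at rank `τ p` in its block. The map cycles each block by
`p ↦ p + 1` mod `n`, so a point starting at position `p` of block `τ` has pattern `i ↦ τ (p + i)`.
For each `σ` and `p` exactly one `τ` gives `σ`, so `σ` is realised on `n` of the `n! * n` cells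
(`card_orderPattern_blockCycle`). A rotation by `√2` inside the cells, in units of the cell length,
destroys all periodicity without affecting which cells are visited. -/

/-- A measurable self-map of `[0,1]` that is injective on a conull set and moves points only by
countably many different translations preserves Lebesgue measure. -/
theorem measurePreserving_of_injOn_of_countable_translations {f : unitInterval → unitInterval}
    (hf : Measurable f) {s : Set unitInterval} (hs : MeasurableSet s)
    (hs' : ∀ᵐ x ∂(volume : Measure unitInterval), x ∈ s) (hinj : Set.InjOn f s)
    {ι : Type*} [Countable ι] (c : ι → ℝ) (hc : ∀ x, ∃ i, (f x : ℝ) = x + c i) :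
    MeasurePreserving f (volume : Measure unitInterval) volume := by
  have himg : ∀ B : Set unitInterval, volume B = volume ((↑) '' B : Set ℝ) := fun B =>
    comap_subtype_coe_apply measurableSet_Icc volume B
  refine ⟨hf, ?_⟩
  have : IsProbabilityMeasure (Measure.map f (volume : Measure unitInterval)) :=
    Measure.isProbabilityMeasure_map hf.aemeasurable
  -- Between probability measures an inequality on all measurable sets forces equality, so
  -- surjectivity is never needed.
  refine Measure.eq_of_le_of_isProbabilityMeasure (Measure.le_iff.2 fun S hS => ?_)
  rw [Measure.map_apply hf hS]
  choose k hk using hc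
  -- Pieces are indexed by the value of the translation, since `c` may repeat values and the pieces
  -- must be disjoint.
  obtain ⟨D, hD⟩ : ∃ D : Set ℝ, D = Set.range c := ⟨_, rfl⟩
  have hDc : Countable D := by rw [hD]; exact (Set.countable_range c).to_subtype
  set A : D → Set unitInterval := fun q => (f ⁻¹' S ∩ s) ∩ {x | (f x : ℝ) - x = q} with hA
  have hAm : ∀ q, MeasurableSet (A q) := fun q =>
    ((hf hS).inter hs).inter
      (measurableSet_eq_fun ((measurable_subtype_coe.comp hf).sub measurable_subtype_coe)
        measurable_const)
  have hAs : ∀ q, A q ⊆ s := fun q x hx => hx.1.2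
  have hAcoe : ∀ q, ((↑) '' (f '' A q) : Set ℝ) = (fun y : ℝ => y + q) '' ((↑) '' A q) := by
    intro q
    rw [Set.image_image, Set.image_image]
    refine Set.image_congr fun x hx => ?_
    have := hx.2
    simp only [Set.mem_ofPred_eq] at this
    linarith
  have hvol : ∀ q, volume (f '' A q) = volume (A q) := fun q => by
    rw [himg, himg, hAcoe, Set.image_add_right, measure_preimage_add_right]
  have hfm : ∀ q, MeasurableSet (f '' A q) := fun q => by
    rw [← (MeasurableEmbedding.subtype_coe measurableSet_Icc).measurableSet_image, hAcoe]
    exact (measurableEmbedding_addRight (q : ℝ)).measurableSet_image.2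
      ((MeasurableEmbedding.subtype_coe measurableSet_Icc).measurableSet_image.2 (hAm q))
  have hdisj : Pairwise (Function.onFun Disjoint fun q => f '' A q) := by
    intro p q hpq
    refine Set.disjoint_left.2 ?_
    rintro _ ⟨x, hx, rfl⟩ ⟨y, hy, hxy⟩
    have : y = x := hinj (hAs q hy) (hAs p hx) hxy
    subst this
    exact hpq (Subtype.ext (hx.2.symm.trans hy.2))
  have hcover : f ⁻¹' S ∩ s = ⋃ q, A q := by
    ext x
    simp only [hA, Set.mem_iUnion, Set.mem_inter_iff, Set.mem_ofPred_eq]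
    refine ⟨fun h => ⟨⟨c (k x), by rw [hD]; exact ⟨_, rfl⟩⟩, h, ?_⟩, fun ⟨q, h, _⟩ => h⟩
    simp [hk x]
  calc volume (f ⁻¹' S) ≤ volume (f ⁻¹' S ∩ s) :=
        measure_mono_ae (by filter_upwards [hs'] with x hx h using ⟨h, hx⟩)
    _ ≤ ∑' q, volume (A q) := by rw [hcover]; exact measure_iUnion_le _
    _ = ∑' q, volume (f '' A q) := by simp_rw [hvol]
    _ = volume (⋃ q, f '' A q) := (measure_iUnion hdisj hfm).symm
    _ ≤ volume S := measure_mono (Set.iUnion_subset fun q => by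
        rintro _ ⟨x, hx, rfl⟩
        exact hx.1.1)

/-! ### Cell permutations combined with an irrational rotation -/

section CellExchange

variable {M : ℕ} [NeZero M]

/-- The index of the cell of `[0,1]`, divided into `M` equal intervals, that contains `x`. -/
noncomputable def cellIndex (M : ℕ) [NeZero M] (x : unitInterval) : Fin M :=
  ⟨min ⌊(M : ℝ) * x⌋₊ (M - 1), by have := NeZero.pos M; omega⟩

theorem measurable_cellIndex : Measurable (cellIndex M) := by
  have h : Measurable fun x : unitInterval => min ⌊(M : ℝ) * x⌋₊ (M - 1) :=
    (Nat.measurable_floor.comp (measurable_subtype_coe.const_mul _)).min measurable_const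
  refine measurable_to_countable' fun j => ?_
  convert h (measurableSet_singleton (j : ℕ)) using 1
  ext x
  simp [cellIndex, Fin.ext_iff]

theorem lt_of_cellIndex_lt {x y : unitInterval} (h : cellIndex M x < cellIndex M y) : x < y := by
  by_contra! hxy
  refine absurd h (not_lt.2 ?_)
  have hle : (M : ℝ) * y ≤ M * x := mul_le_mul_of_nonneg_left hxy (Nat.cast_nonneg _)
  exact Fin.mk_le_mk.2 (min_le_min (Nat.floor_le_floor hle) le_rfl)

theorem cellIndex_of_floor {x : unitInterval} {j : Fin M} (h : ⌊(M : ℝ) * x⌋₊ = j) :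
    cellIndex M x = j := by
  ext
  simp only [cellIndex, h]
  omega

theorem cellIndex_val_of_lt_one {x : unitInterval} (hx : (x : ℝ) < 1) :
    (cellIndex M x : ℕ) = ⌊(M : ℝ) * x⌋₊ := by
  have hM : (0 : ℝ) < M := Nat.cast_pos.2 (NeZero.pos M)
  have h : ⌊(M : ℝ) * x⌋₊ < M :=
    (Nat.floor_lt (mul_nonneg hM.le x.2.1)).2 (by nlinarith)
  simp only [cellIndex]
  omega

theorem ae_lt_one : ∀ᵐ x ∂(volume : Measure unitInterval), ((x : unitInterval) : ℝ) < 1 := by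
  have h : ∀ᵐ x ∂(volume : Measure unitInterval), x ≠ 1 := by
    simp [ae_iff]
  filter_upwards [h] with x hx
  exact lt_of_le_of_ne x.2.2 fun h => hx (Subtype.ext h)

theorem volume_cellIndex_eq (j : Fin M) :
    volume {x : unitInterval | cellIndex M x = j} = (M : ℝ≥0∞)⁻¹ := by
  have hM : (0 : ℝ) < M := Nat.cast_pos.2 (NeZero.pos M)
  have hj : ((j : ℕ) : ℝ) + 1 ≤ M := by exact_mod_cast j.2
  have h1 : volume {x : unitInterval | cellIndex M x = j} =
      volume (((↑) : unitInterval → ℝ) ⁻¹' Set.Ico ((j : ℝ) / M) ((j + 1) / M)) := by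
    refine measure_congr ?_
    filter_upwards [ae_lt_one] with x hx
    refine propext ?_
    change cellIndex M x = j ↔ (x : ℝ) ∈ Set.Ico ((j : ℝ) / M) ((j + 1) / M)
    rw [Fin.ext_iff, cellIndex_val_of_lt_one hx, Nat.floor_eq_iff (mul_nonneg hM.le x.2.1),
      Set.mem_Ico, div_le_iff₀' hM, lt_div_iff₀' hM]
  have h2 : (Set.Ico ((j : ℝ) / M) ((j + 1) / M)) ⊆ Set.Icc (0 : ℝ) 1 := fun x hx =>
    ⟨le_trans (by positivity) hx.1, hx.2.le.trans ((div_le_one hM).2 hj)⟩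
  rw [h1]
  refine (comap_subtype_coe_apply measurableSet_Icc volume _).trans ?_
  rw [Subtype.image_preimage_coe, Set.inter_eq_right.2 h2, Real.volume_Ico, ← sub_div,
    add_sub_cancel_left, one_div, ENNReal.ofReal_inv_of_pos hM, ENNReal.ofReal_natCast]

/-- The self-map of `[0,1]` that permutes the `M` cells by `π` and rotates inside each of them by
the irrational angle `√2`. -/
noncomputable def cellExchange (π : Equiv.Perm (Fin M)) (x : unitInterval) : unitInterval :=
  ⟨(π (cellIndex M x) + Int.fract ((M : ℝ) * x + √2)) / M, by
    have hM : (0 : ℝ) < M := Nat.cast_pos.2 (NeZero.pos M)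
    have hj : ((π (cellIndex M x) : ℕ) : ℝ) + 1 ≤ M := by exact_mod_cast (π (cellIndex M x)).2
    have h0 := Int.fract_nonneg ((M : ℝ) * x + √2)
    have h1 := Int.fract_lt_one ((M : ℝ) * x + √2)
    exact ⟨by positivity, (div_le_one hM).2 (by linarith)⟩⟩

variable (π : Equiv.Perm (Fin M))

theorem mul_cellExchange (x : unitInterval) :
    (M : ℝ) * cellExchange π x = π (cellIndex M x) + Int.fract ((M : ℝ) * x + √2) :=
  mul_div_cancel₀ _ (Nat.cast_ne_zero.2 (NeZero.ne M))

theorem cellIndex_cellExchange (x : unitInterval) :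
    cellIndex M (cellExchange π x) = π (cellIndex M x) := by
  refine cellIndex_of_floor ?_
  rw [mul_cellExchange, add_comm, Nat.floor_add_natCast (Int.fract_nonneg _),
    Nat.floor_eq_zero.2 (Int.fract_lt_one _), zero_add]

theorem cellIndex_iterate_cellExchange (x : unitInterval) (k : ℕ) :
    cellIndex M ((cellExchange π)^[k] x) = (π ^ k) (cellIndex M x) := by
  induction k with
  | zero => rfl
  | succ k ih => rw [Function.iterate_succ_apply', cellIndex_cellExchange, ih, pow_succ']; rfl

/-- The position inside the cell evolves as a circle rotation, whatever `π` is; a repeated iterate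
would then make a nonzero integer multiple of `√2` an integer. -/
theorem fract_mul_iterate_cellExchange (x : unitInterval) (k : ℕ) :
    Int.fract ((M : ℝ) * (cellExchange π)^[k] x) = Int.fract ((M : ℝ) * x + k * √2) := by
  induction k with
  | zero => simp
  | succ k ih =>
    rw [Function.iterate_succ_apply', mul_cellExchange, Int.fract_natCast_add, Int.fract_fract]
    obtain ⟨z, hz⟩ := Int.fract_eq_fract.1 ih
    refine Int.fract_eq_fract.2 ⟨z, ?_⟩
    push_cast
    linarith

theorem aperiodicPoints_cellExchange : aperiodicPoints (cellExchange π) = Set.univ := by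
  refine Set.eq_univ_of_forall fun x => Set.infinite_range_of_injective fun a b hab => ?_
  have h : Int.fract ((M : ℝ) * x + a * √2) = Int.fract ((M : ℝ) * x + b * √2) := by
    rw [← fract_mul_iterate_cellExchange π, ← fract_mul_iterate_cellExchange π]
    exact congrArg (fun y : unitInterval => Int.fract ((M : ℝ) * y)) hab
  obtain ⟨z, hz⟩ := Int.fract_eq_fract.1 h
  by_contra hne
  have hne' : ((a : ℤ) - b) ≠ 0 := by omega
  refine (irrational_sqrt_two.intCast_mul hne').ne_int z ?_
  push_cast
  linarith

theorem measurable_cellExchange : Measurable (cellExchange π) := by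
  refine Measurable.subtype_mk (Measurable.div_const (Measurable.add ?_ ?_) _)
  · exact (measurable_of_countable fun j : Fin M => ((π j : ℕ) : ℝ)).comp measurable_cellIndex
  · exact measurable_fract.comp ((measurable_subtype_coe.const_mul _).add_const _)

theorem measurePreserving_cellExchange :
    MeasurePreserving (cellExchange π) (volume : Measure unitInterval) volume := by
  have hM : (0 : ℝ) < M := Nat.cast_pos.2 (NeZero.pos M)
  refine measurePreserving_of_injOn_of_countable_translations (measurable_cellExchange π)
    -- The endpoint `1` is put in the last cell and has the same image as that cell's left endpoint,
    -- so injectivity holds only without it.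
    (s := {x | (x : ℝ) < 1}) (measurableSet_lt measurable_subtype_coe measurable_const)
    ae_lt_one ?_ (fun z : ℤ => (z + √2) / M) ?_
  · intro x hx y hy hxy
    have hcell : cellIndex M x = cellIndex M y := π.injective <| by
      rw [← cellIndex_cellExchange, ← cellIndex_cellExchange, hxy]
    have hfr : Int.fract ((M : ℝ) * x + √2) = Int.fract ((M : ℝ) * y + √2) := by
      have h := mul_cellExchange π x
      rw [hxy, mul_cellExchange π y, hcell] at h
      linarith
    have hfl : ⌊(M : ℝ) * x⌋₊ = ⌊(M : ℝ) * y⌋₊ := by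
      rw [← cellIndex_val_of_lt_one hx, ← cellIndex_val_of_lt_one hy, hcell]
    obtain ⟨z, hz⟩ := Int.fract_eq_fract.1 hfr
    have hx0 := Nat.floor_le (mul_nonneg hM.le x.2.1)
    have hx1 := Nat.lt_floor_add_one ((M : ℝ) * x)
    have hy0 := Nat.floor_le (mul_nonneg hM.le y.2.1)
    have hy1 := Nat.lt_floor_add_one ((M : ℝ) * y)
    rw [hfl] at hx0 hx1
    have hz1 : (z : ℝ) < 1 := by linarith
    have hz2 : (-1 : ℝ) < z := by linarith
    have hz0 : z = 0 := by
      have h1 : z < 1 := by exact_mod_cast hz1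
      have h2 : -1 < z := by exact_mod_cast hz2
      omega
    rw [hz0, Int.cast_zero] at hz
    exact Subtype.ext (mul_left_cancel₀ hM.ne' (by linarith))
  · intro x
    refine ⟨π (cellIndex M x) - ⌊(M : ℝ) * x + √2⌋, mul_left_cancel₀ hM.ne' ?_⟩
    rw [mul_cellExchange, mul_add, mul_div_cancel₀ _ hM.ne', ← Int.self_sub_floor]
    push_cast
    ring

/-- The first `n` iterates lie in distinct cells, so comparing cells already compares points. -/
theorem orderPattern_cellExchange {n : ℕ} (x : unitInterval)
    (h : Function.Injective fun i : Fin n => (π ^ (i : ℕ)) (cellIndex M x)) :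
    orderPattern (fun i : Fin n => (cellExchange π)^[i] x) =
      orderPattern fun i : Fin n => (π ^ (i : ℕ)) (cellIndex M x) := by
  have key : ∀ i j : Fin n, (π ^ (i : ℕ)) (cellIndex M x) < (π ^ (j : ℕ)) (cellIndex M x) →
      (cellExchange π)^[i] x < (cellExchange π)^[j] x := fun i j hij =>
    lt_of_cellIndex_lt (M := M) (by simpa only [cellIndex_iterate_cellExchange] using hij)
  have hinj : Function.Injective fun i : Fin n => (cellExchange π)^[i] x := fun i j hij => by
    refine h ?_
    simp only [← cellIndex_iterate_cellExchange]
    exact congrArg (cellIndex M) hij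
  refine (eq_orderPattern hinj _ fun i j => ?_).symm
  rw [← orderPattern_lt_iff h]
  refine ⟨fun hij => ?_, key i j⟩
  by_contra! hle
  rcases hle.lt_or_eq with hlt | heq
  · exact lt_asymm hij (key j i hlt)
  · exact hij.ne (congrArg (fun i : Fin n => (cellExchange π)^[i] x) (h heq).symm)

theorem patternDistribution_cellExchange {n : ℕ}
    (h : ∀ j, Function.Injective fun i : Fin n => (π ^ (i : ℕ)) j) (σ : Equiv.Perm (Fin n)) :
    patternDistribution n (cellExchange π) σ =
      (Finset.univ.filter fun j => orderPattern (fun i : Fin n => (π ^ (i : ℕ)) j) = σ).card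
        * (M : ℝ≥0∞)⁻¹ := by
  classical
  have hset : {x : unitInterval | x ∈ aperiodicPoints (cellExchange π) ∧
      orderPattern (fun i : Fin n => (cellExchange π)^[(i : ℕ)] x) = σ} =
      ⋃ j ∈ Finset.univ.filter fun j => orderPattern (fun i : Fin n => (π ^ (i : ℕ)) j) = σ,
        {x | cellIndex M x = j} := by
    ext x
    simp [aperiodicPoints_cellExchange, orderPattern_cellExchange π x (h _)]
  rw [patternDistribution, hset, measure_biUnion_finset]
  · simp [volume_cellIndex_eq]
  · intro i _ j _ hij
    exact Set.disjoint_left.2 fun x hi hj => hij (hi.symm.trans hj)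
  · exact fun j _ => measurable_cellIndex (measurableSet_singleton j)

end CellExchange

/-! ### A cell permutation with equidistributed patterns -/

section UniformPatterns

variable (n : ℕ)

/-- The enumeration of pairs `(τ, p)` that lists, in one block for each permutation `τ`, the
positions `p` in increasing order of `τ p`. -/
noncomputable def blockEquiv :
    Equiv.Perm (Fin n) × Fin n ≃ Fin (Fintype.card (Equiv.Perm (Fin n)) * n) :=
  (Equiv.prodShear (Fintype.equivFin (Equiv.Perm (Fin n))) fun τ => τ).trans finProdFinEquiv

theorem blockEquiv_lt_iff (τ : Equiv.Perm (Fin n)) (p q : Fin n) :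
    blockEquiv n (τ, p) < blockEquiv n (τ, q) ↔ τ p < τ q := by
  simp [blockEquiv, ← Fin.val_fin_lt]

variable [NeZero n]

/-- The permutation of cells that runs cyclically through each block in the order of positions. -/
noncomputable def blockCycle : Equiv.Perm (Fin (Fintype.card (Equiv.Perm (Fin n)) * n)) :=
  (blockEquiv n).permCongr ((Equiv.refl _).prodCongr (Equiv.addRight (1 : Fin n)))

theorem blockCycle_pow_apply (τ : Equiv.Perm (Fin n)) (p : Fin n) (k : ℕ) :
    (blockCycle n ^ k) (blockEquiv n (τ, p)) = blockEquiv n (τ, p + Fin.ofNat n k) := by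
  induction k with
  | zero => simp
  | succ k ih =>
    rw [pow_succ', Equiv.Perm.mul_apply, ih]
    have h : Fin.ofNat n (k + 1) = Fin.ofNat n k + 1 := by
      ext
      simp [Fin.val_add]
    rw [h]
    simp [blockCycle, Equiv.permCongr_apply, add_assoc]

theorem injective_blockCycle_pow_apply (j) :
    Function.Injective fun i : Fin n => (blockCycle n ^ (i : ℕ)) j := by
  obtain ⟨⟨τ, p⟩, rfl⟩ := (blockEquiv n).surjective j
  intro a b hab
  simpa [blockCycle_pow_apply] using hab

theorem orderPattern_blockCycle (τ : Equiv.Perm (Fin n)) (p : Fin n) :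
    orderPattern (fun i : Fin n => (blockCycle n ^ (i : ℕ)) (blockEquiv n (τ, p))) =
      τ * Equiv.addLeft p := by
  refine (eq_orderPattern (injective_blockCycle_pow_apply n _) _ fun i j => ?_).symm
  simp [blockCycle_pow_apply, blockEquiv_lt_iff]

theorem card_orderPattern_blockCycle (σ : Equiv.Perm (Fin n)) :
    (Finset.univ.filter fun j =>
      orderPattern (fun i : Fin n => (blockCycle n ^ (i : ℕ)) j) = σ).card = n := by
  have h : (Finset.univ.filter fun j =>
      orderPattern (fun i : Fin n => (blockCycle n ^ (i : ℕ)) j) = σ) =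
      (Finset.univ : Finset (Fin n)).image
        fun p => blockEquiv n (σ * (Equiv.addLeft p)⁻¹, p) := by
    ext j
    obtain ⟨⟨τ, p⟩, rfl⟩ := (blockEquiv n).surjective j
    simp only [Finset.mem_filter, Finset.mem_univ, true_and, orderPattern_blockCycle,
      Finset.mem_image, (blockEquiv n).apply_eq_iff_eq, Prod.mk.injEq]
    -- For fixed `p`, the equation `τ * Equiv.addLeft p = σ` has a unique solution `τ`.
    refine ⟨fun h => ⟨p, ?_, rfl⟩, ?_⟩
    · rw [← h, mul_inv_cancel_right]
    · rintro ⟨q, h, rfl⟩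
      rw [← h, inv_mul_cancel_right]
  rw [h, Finset.card_image_of_injective, Finset.card_univ, Fintype.card_fin]
  intro p q hpq
  exact (Prod.mk.inj ((blockEquiv n).injective hpq)).2

end UniformPatterns

theorem mainTheorem3 (n : ℕ) (hn : 1 ≤ n) :
    ∃ f ∈ almostAperiodicMeasurePreserving,
      ∀ σ : Equiv.Perm (Fin n), patternDistribution n f σ = 1 / (n ! : ℝ≥0∞) := by
  have hn0 : n ≠ 0 := Nat.one_le_iff_ne_zero.1 hn
  have : NeZero n := ⟨hn0⟩
  have : NeZero (Fintype.card (Equiv.Perm (Fin n)) * n) := ⟨mul_ne_zero Fintype.card_ne_zero hn0⟩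
  refine ⟨cellExchange (blockCycle n), ⟨?_, measurePreserving_cellExchange _⟩, fun σ => ?_⟩
  · simp [AlmostAperiodic, aperiodicPoints_cellExchange]
  · rw [patternDistribution_cellExchange _ (injective_blockCycle_pow_apply n),
      card_orderPattern_blockCycle, Fintype.card_perm, Fintype.card_fin, Nat.cast_mul,
      ENNReal.mul_inv (Or.inr (ENNReal.natCast_ne_top n)) (Or.inl (ENNReal.natCast_ne_top _)),
      mul_left_comm, ENNReal.mul_inv_cancel (Nat.cast_ne_zero.2 hn0) (ENNReal.natCast_ne_top n),
      mul_one, one_div]
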